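/- Call a finite group $G$ a Beauville group if there are elements $x_1,y_1,x_2,y_2\in G$ with $\langle x_1,y_1\rangle=\langle x_2,y_2\rangle=G$ and $\Sigma(x_1,y_1)\cap\Sigma(x_2,y_2)=\{e\}$, where $e$ is the identity and $$\Sigma(x,y)=\bigcup_{i=1}^{|G|}\bigcup_{g\in G}\{g^{-1}x^ig,\ g^{-1}y^ig,\ g^{-1}(xy)^ig\};$$ such a choice $\{\{x_1,y_1\},\{x_2,y_2\}\}$ is called a Beauville structure for $G$. A Beauville group $G$ is strongly real if it has a Beauville structure $\{\{x_1,y_1\},\{x_2,y_2\}\}$ for which there exist an automorphism $\phi\in\mathrm{Aut}(G)$ and elements $g_1,g_2\in G$ with $$g_i\phi(x_i)g_i^{-1}=x_i^{-1}\quad\text{and}\quad g_i\phi(y_i)g_i^{-1}=y_i^{-1}\qquad(i=1,2).$$ Let $n\geq 12$ be an even integer and let $k$ be a positive integer with $k\leq (n-8)/4$. Then $A_n^k$, the direct product of $k$ copies of the alternating group of degree $n$, is a strongly real Beauville group. -/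

import Mathlib

/-- The set `Σ(x, y)`: all `G`-conjugates `g⁻¹ * z ^ i * g`, with `1 ≤ i ≤ |G|`, of the powers of
`x`, `y` and `x * y`, for a finite group `G`. -/
def beauvilleSigma {G : Type*} [Group G] [Finite G] (x y : G) : Set G :=
  ⋃ i ∈ Set.Icc 1 (Nat.card G), ⋃ g : G,
    {g⁻¹ * x ^ i * g, g⁻¹ * y ^ i * g, g⁻¹ * (x * y) ^ i * g}

/-- `{{x₁, y₁}, {x₂, y₂}}` is an unmixed Beauville structure for the finite group `G`. -/
structure IsBeauvilleStructure {G : Type*} [Group G] [Finite G] (x₁ y₁ x₂ y₂ : G) : Prop where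
  closure_fst : Subgroup.closure {x₁, y₁} = (⊤ : Subgroup G)
  closure_snd : Subgroup.closure {x₂, y₂} = (⊤ : Subgroup G)
  sigma_inter : beauvilleSigma x₁ y₁ ∩ beauvilleSigma x₂ y₂ = {1}

/-- A finite group is a Beauville group if it has a Beauville structure. -/
def IsBeauvilleGroup (G : Type*) [Group G] [Finite G] : Prop :=
  ∃ x₁ y₁ x₂ y₂ : G, IsBeauvilleStructure x₁ y₁ x₂ y₂

/-- A Beauville structure is strongly real if a single automorphism of `G`, followed by an inner
automorphism for each of the two pairs, inverts both members of each pair. -/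
structure IsStronglyRealBeauvilleStructure {G : Type*} [Group G] [Finite G]
    (x₁ y₁ x₂ y₂ : G) : Prop where
  isBeauvilleStructure : IsBeauvilleStructure x₁ y₁ x₂ y₂
  exists_inverting : ∃ (φ : G ≃* G) (g₁ g₂ : G),
    (g₁ * φ x₁ * g₁⁻¹ = x₁⁻¹ ∧ g₁ * φ y₁ * g₁⁻¹ = y₁⁻¹) ∧
    (g₂ * φ x₂ * g₂⁻¹ = x₂⁻¹ ∧ g₂ * φ y₂ * g₂⁻¹ = y₂⁻¹)

/-- A finite group is a strongly real Beauville group if it is a Beauville group that has a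
strongly real Beauville structure. -/
def IsStronglyRealBeauvilleGroup (G : Type*) [Group G] [Finite G] : Prop :=
  IsBeauvilleGroup G ∧ ∃ x₁ y₁ x₂ y₂ : G, IsStronglyRealBeauvilleStructure x₁ y₁ x₂ y₂

/-!
For each `i < k` two generating pairs of the alternating group are written down, so that the `i`-th
coordinates of the two sides of the Beauville structure are the two pairs with index `i`.

* On `ZMod (n - 2) ⊕ ZMod 2`: the simultaneous rotation `x` of both summands and a 3-cycle `y`
  through `inr 0`, `inl 0` and `inl j`, for an odd number `j` depending on `i`. The elements `x` and
  `x * y` have two cycles each, of lengths `n - 2`, `2` and `j + 2`, `n - 2 - j`.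
* On `ZMod (n - 1)` with one further point `∞`: the rotation `x` and a 5-cycle `y` through `∞`,
  `-(r + 1)`, `0`, `-1`, `r`, for `r = i + 1`. The elements `x` and `x * y` are both
  `(n - 1)`-cycles.

The Beauville condition is a count: a nontrivial power of `x`, `y` or `x * y` moves `5` or `n - 1`
points for a pair of the second kind, and never `5` or `n - 1` points for a pair of the first kind,
provided that `j + 2` and `n - 2 - j` avoid these values. In both cases a reflection inverts `x` and
`y`, and both reflections have exactly two fixed points, hence the same sign; this is why the two
pairs can be inverted by the same automorphism up to inner automorphisms of the alternating group.

Each pair generates the alternating group by Jordan's theorem on primitive groups containing a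
3-cycle. For the second kind the 3-cycle is the commutator of `y` with a conjugate of `y` by a power
of `x` with which it shares only the point `∞`.

That the pairs of one kind together generate the `k`-th power follows from a Goursat-type criterion
for nonabelian simple groups (`Subgroup.eq_top_of_proj_surjective_of_separates`): it is enough that
for any two indices some word in the free group vanishes on one pair and not on the other. For the
first kind this is the commutator of `y` with `x ^ t * y * x⁻¹ ^ t`, `t` odd, which is trivial
unless `t` is the parameter `j` of the pair. For the second kind it is the fourth power of
`y * y'⁻¹`, where `y'` is the conjugate of `y` by the power of `x` whose exponent is `2 * r + 1` for one
of the two pairs; how `y` and `y'` overlap determines whether it vanishes, and this leaves finitely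
many computations with permutations of at most nine points, which are transported along an
embedding.
-/

open Equiv Equiv.Perm

/-! ### Generating powers of a simple group -/

section Products

variable {ι S : Type*} [Group S]

/-- If a subgroup of a power of a simple group projects onto the factor `i`, then the set of
`i`-th coordinates of its elements that vanish on a given set of coordinates is either trivial or
everything, being a normal subgroup. -/
theorem Subgroup.exists_mem_eq_of_forall_mem_eq_one [IsSimpleGroup S] (H : Subgroup (ι → S))
    (i : ι) (hproj : ∀ s, ∃ h ∈ H, h i = s) (T : Set ι)
    (hT : ∃ h ∈ H, (∀ l ∈ T, h l = 1) ∧ h i ≠ 1) (s : S) :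
    ∃ h ∈ H, (∀ l ∈ T, h l = 1) ∧ h i = s := by
  let N : Subgroup S :=
    { carrier := {s | ∃ h ∈ H, (∀ l ∈ T, h l = 1) ∧ h i = s}
      one_mem' := ⟨1, H.one_mem, fun _ _ => rfl, rfl⟩
      mul_mem' := by
        rintro _ _ ⟨a, ha, ha1, rfl⟩ ⟨b, hb, hb1, rfl⟩
        exact ⟨a * b, H.mul_mem ha hb, fun l hl => by simp [ha1 l hl, hb1 l hl], rfl⟩
      inv_mem' := by
        rintro _ ⟨a, ha, ha1, rfl⟩
        exact ⟨a⁻¹, H.inv_mem ha, fun l hl => by simp [ha1 l hl], rfl⟩ }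
  have hN : N.Normal := by
    refine ⟨?_⟩
    rintro _ ⟨a, ha, ha1, rfl⟩ g
    obtain ⟨b, hb, rfl⟩ := hproj g
    exact ⟨b * a * b⁻¹, H.mul_mem (H.mul_mem hb ha) (H.inv_mem hb),
      fun l hl => by simp [ha1 l hl], rfl⟩
  obtain hbot | htop := hN.eq_bot_or_eq_top
  · obtain ⟨h, hh, h1, h2⟩ := hT
    have : h i ∈ N := ⟨h, hh, h1, rfl⟩
    rw [hbot, Subgroup.mem_bot] at this
    exact absurd this h2
  · have : s ∈ N := htop ▸ Subgroup.mem_top s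
    exact this

/-- A Goursat-type criterion: a subgroup of a finite power of a nonabelian simple group is
everything as soon as it projects onto each factor and separates any two factors. -/
theorem Subgroup.eq_top_of_proj_surjective_of_separates [IsSimpleGroup S] [Finite ι]
    (hS : ∃ a b : S, a * b ≠ b * a) (H : Subgroup (ι → S))
    (hproj : ∀ i s, ∃ h ∈ H, h i = s)
    (hsep : ∀ i l, i ≠ l → ∃ h ∈ H, h i = 1 ∧ h l ≠ 1) : H = ⊤ := by
  classical
  obtain ⟨a, b, hab⟩ := hS
  have key : ∀ (i : ι) (T : Finset ι), i ∉ T →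
      ∀ s, ∃ h ∈ H, (∀ l ∈ (T : Set ι), h l = 1) ∧ h i = s := by
    intro i T
    induction T using Finset.induction_on with
    | empty =>
      intro _ s
      obtain ⟨h, hh, rfl⟩ := hproj i s
      exact ⟨h, hh, by simp, rfl⟩
    | insert l T _ ih =>
      intro hi
      rw [Finset.mem_insert, not_or] at hi
      apply H.exists_mem_eq_of_forall_mem_eq_one i (hproj i)
      obtain ⟨p, hp, hpT, rfl⟩ := ih hi.2 a
      obtain ⟨q, hq, hql, rfl⟩ := H.exists_mem_eq_of_forall_mem_eq_one i (hproj i) {l}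
        (by simpa using hsep l i (Ne.symm hi.1)) b
      -- The commutator vanishes wherever one of its two entries does.
      refine ⟨p * q * p⁻¹ * q⁻¹, H.mul_mem (H.mul_mem (H.mul_mem hp hq) (H.inv_mem hp))
        (H.inv_mem hq), fun m hm => ?_, fun h => hab ?_⟩
      · rw [Finset.coe_insert, Set.mem_insert_iff] at hm
        obtain rfl | hm := hm
        · simp [hql m rfl]
        · simp [hpT m hm]
      · simpa [mul_inv_eq_iff_eq_mul] using h
  have := Fintype.ofFinite ι
  refine (Subgroup.eq_top_iff' H).2 fun g => Subgroup.pi_mem_of_mulSingle_mem g fun i => ?_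
  obtain ⟨h, hh, h1, h2⟩ := key i (Finset.univ.erase i) (by simp) (g i)
  convert hh using 1
  funext l
  obtain rfl | hl := eq_or_ne l i
  · simp [h2]
  · simp [hl, h1 l (by simp [hl])]

end Products

/-! ### Strongly real Beauville structures from families of pairs -/

/-- A family of pairs `(x i, y i)` of even permutations of `α`, each generating the alternating
group and simultaneously inverted by a permutation `σ i` of sign `ε`, such that no two members of
the family satisfy the same relations, and such that the number of points moved by a nontrivial
power of `x i`, `y i` or `x i * y i` lies in `N`. The pair is indexed by `Bool` so that words in it
are elements of the free group on `Bool`. -/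
structure RealPairFamily (α : Type*) [Fintype α] [DecidableEq α] (ι : Type*) (ε : ℤˣ)
    (N : Set ℕ) where
  /-- the first generator -/
  x : ι → Perm α
  /-- the second generator -/
  y : ι → Perm α
  /-- the permutation inverting both generators -/
  σ : ι → Perm α
  sign_x : ∀ i, sign (x i) = 1
  sign_y : ∀ i, sign (y i) = 1
  sign_σ : ∀ i, sign (σ i) = ε
  alternatingGroup_le : ∀ i, alternatingGroup α ≤ Subgroup.closure {x i, y i}
  separated : ∀ i l, i ≠ l → ∃ w : FreeGroup Bool,
    FreeGroup.lift (fun b => cond b (x i) (y i)) w = 1 ∧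
      FreeGroup.lift (fun b => cond b (x l) (y l)) w ≠ 1
  inverts_x : ∀ i, σ i * x i * (σ i)⁻¹ = (x i)⁻¹
  inverts_y : ∀ i, σ i * y i * (σ i)⁻¹ = (y i)⁻¹
  card_support_x : ∀ i (m : ℕ), x i ^ m ≠ 1 → (x i ^ m).support.card ∈ N
  card_support_y : ∀ i (m : ℕ), y i ^ m ≠ 1 → (y i ^ m).support.card ∈ N
  card_support_mul : ∀ i (m : ℕ), (x i * y i) ^ m ≠ 1 → ((x i * y i) ^ m).support.card ∈ N

namespace RealPairFamily

variable {α β ι : Type*} [Fintype α] [DecidableEq α] [Fintype β] [DecidableEq β] {ε : ℤˣ}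
  {N : Set ℕ}

theorem card_support_permCongrHom (e : α ≃ β) (f : Perm α) :
    (e.permCongrHom f).support.card = f.support.card := by
  have : (e.permCongrHom f).support = f.support.map e.toEmbedding := by
    ext b
    simp [Finset.mem_map_equiv, Equiv.permCongrHom, Equiv.eq_symm_apply]
  rw [this, Finset.card_map]

theorem sign_permCongrHom (e : α ≃ β) (f : Perm α) : sign (e.permCongrHom f) = sign f :=
  sign_permCongr e f

/-- Transport of a family of pairs along a bijection of the underlying sets. -/
def map (F : RealPairFamily α ι ε N) (e : α ≃ β) : RealPairFamily β ι ε N where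
  x i := e.permCongrHom (F.x i)
  y i := e.permCongrHom (F.y i)
  σ i := e.permCongrHom (F.σ i)
  sign_x i := by rw [sign_permCongrHom, F.sign_x]
  sign_y i := by rw [sign_permCongrHom, F.sign_y]
  sign_σ i := by rw [sign_permCongrHom, F.sign_σ]
  alternatingGroup_le i g hg := by
    have h1 : e.permCongrHom.symm g ∈ Subgroup.closure {F.x i, F.y i} := by
      apply F.alternatingGroup_le i
      rw [mem_alternatingGroup, ← sign_permCongrHom e, MulEquiv.apply_symm_apply]
      exact hg
    have h2 := Subgroup.mem_map_of_mem e.permCongrHom.toMonoidHom h1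
    rw [MonoidHom.map_closure, Set.image_pair] at h2
    have h3 : e.permCongrHom (e.permCongrHom.symm g) = g := e.permCongrHom.apply_symm_apply g
    exact h3 ▸ h2
  separated i l hil := by
    obtain ⟨w, h1, h2⟩ := F.separated i l hil
    have key : ∀ j, FreeGroup.lift (fun b => cond b (e.permCongrHom (F.x j))
        (e.permCongrHom (F.y j))) w =
        e.permCongrHom (FreeGroup.lift (fun b => cond b (F.x j) (F.y j)) w) := by
      intro j
      exact (FreeGroup.lift_unique (e.permCongrHom.toMonoidHom.comp
        (FreeGroup.lift (fun b => cond b (F.x j) (F.y j))))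
        (by intro b; cases b <;> simp)).symm
    refine ⟨w, ?_, ?_⟩
    · rw [key, h1, map_one]
    · rw [key]
      exact fun h => h2 ((MulEquiv.map_eq_one_iff _).1 h)
  inverts_x i := by rw [← map_inv, ← map_mul, ← map_mul, F.inverts_x, map_inv]
  inverts_y i := by rw [← map_inv, ← map_mul, ← map_mul, F.inverts_y, map_inv]
  card_support_x i m h := by
    rw [← map_pow] at h ⊢
    rw [card_support_permCongrHom]
    exact F.card_support_x i m fun h' => h (by rw [h', map_one])
  card_support_y i m h := by
    rw [← map_pow] at h ⊢
    rw [card_support_permCongrHom]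
    exact F.card_support_y i m fun h' => h (by rw [h', map_one])
  card_support_mul i m h := by
    rw [← map_mul, ← map_pow] at h ⊢
    rw [card_support_permCongrHom]
    exact F.card_support_mul i m fun h' => h (by rw [h', map_one])

/-- The first generators of a family, as one element of a power of the alternating group. -/
def fst (F : RealPairFamily α ι ε N) : ι → alternatingGroup α :=
  fun i => ⟨F.x i, F.sign_x i⟩

/-- The second generators of a family, as one element of a power of the alternating group. -/
def snd (F : RealPairFamily α ι ε N) : ι → alternatingGroup α :=
  fun i => ⟨F.y i, F.sign_y i⟩

theorem closure_fst_snd [Finite ι] (F : RealPairFamily α ι ε N) (hα : 5 ≤ Fintype.card α) :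
    Subgroup.closure {F.fst, F.snd} = ⊤ := by
  have hα' : 5 ≤ Nat.card α := by rwa [Nat.card_eq_fintype_card]
  have := alternatingGroup.isSimpleGroup hα'
  apply Subgroup.eq_top_of_proj_surjective_of_separates
  · by_contra! h
    have : IsMulCommutative (alternatingGroup α) := ⟨⟨h⟩⟩
    rw [alternatingGroup.isMulCommutative_iff_card_le_three] at this
    omega
  · rintro i ⟨g, hg⟩
    have h1 : g ∈ (((Subgroup.closure {F.fst, F.snd}).map
        (Pi.evalMonoidHom (fun _ => alternatingGroup α) i))).map (alternatingGroup α).subtype := by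
      rw [MonoidHom.map_closure, Set.image_pair, MonoidHom.map_closure, Set.image_pair]
      exact F.alternatingGroup_le i hg
    obtain ⟨⟨g', hg'⟩, ⟨h, hh, hhg⟩, rfl⟩ := h1
    exact ⟨h, hh, hhg⟩
  · intro i l hil
    obtain ⟨w, h1, h2⟩ := F.separated i l hil
    have key : ∀ j, FreeGroup.lift (fun b => cond b (F.x j) (F.y j)) w =
        ((FreeGroup.lift (fun b => cond b F.fst F.snd) w) j : Perm α) := by
      intro j
      exact (FreeGroup.lift_unique ((alternatingGroup α).subtype.comp
        ((Pi.evalMonoidHom (fun _ => alternatingGroup α) j).comp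
          (FreeGroup.lift (fun b => cond b F.fst F.snd))))
        (by intro b; cases b <;> simp [fst, snd])).symm
    refine ⟨FreeGroup.lift (fun b => cond b F.fst F.snd) w, ?_, ?_, ?_⟩
    · have h3 : (FreeGroup.lift (fun b => cond b F.fst F.snd)).range ≤
          Subgroup.closure {F.fst, F.snd} := by
        apply FreeGroup.range_lift_le
        rintro _ ⟨b, rfl⟩
        cases b
        · exact Subgroup.subset_closure (by simp)
        · exact Subgroup.subset_closure (by simp)
      exact h3 ⟨w, rfl⟩
    · rw [key] at h1
      exact_mod_cast h1
    · rw [key] at h2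
      exact_mod_cast h2

theorem card_support_of_mem_beauvilleSigma [Finite ι] (F : RealPairFamily α ι ε N)
    {g : ι → alternatingGroup α} (hg : g ∈ beauvilleSigma F.fst F.snd) (i : ι) (hi : g i ≠ 1) :
    (g i : Perm α).support.card ∈ N := by
  simp only [beauvilleSigma, Set.mem_iUnion, Set.mem_insert_iff, Set.mem_singleton_iff] at hg
  obtain ⟨m, -, h, hg⟩ := hg
  have conj_card : ∀ p : Perm α, ((h i : Perm α)⁻¹ * p * (h i : Perm α)).support.card =
      p.support.card := fun p => by
    simpa using card_support_conj (σ := (h i : Perm α)⁻¹) (τ := p)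
  have hi' : (g i : Perm α) ≠ 1 := by exact_mod_cast hi
  obtain rfl | rfl | rfl := hg
  · have h1 : (((h⁻¹ * F.fst ^ m * h) i : alternatingGroup α) : Perm α) =
      (h i : Perm α)⁻¹ * F.x i ^ m * (h i : Perm α) := rfl
    rw [h1] at hi' ⊢
    rw [conj_card]
    exact F.card_support_x i m fun h => hi' (by simp [h])
  · have h1 : (((h⁻¹ * F.snd ^ m * h) i : alternatingGroup α) : Perm α) =
      (h i : Perm α)⁻¹ * F.y i ^ m * (h i : Perm α) := rfl
    rw [h1] at hi' ⊢
    rw [conj_card]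
    exact F.card_support_y i m fun h => hi' (by simp [h])
  · have h1 : (((h⁻¹ * (F.fst * F.snd) ^ m * h) i : alternatingGroup α) : Perm α) =
      (h i : Perm α)⁻¹ * (F.x i * F.y i) ^ m * (h i : Perm α) := rfl
    rw [h1] at hi' ⊢
    rw [conj_card]
    exact F.card_support_mul i m fun h => hi' (by simp [h])

theorem one_mem_beauvilleSigma {G : Type*} [Group G] [Finite G] (x y : G) :
    (1 : G) ∈ beauvilleSigma x y := by
  simp only [beauvilleSigma, Set.mem_iUnion]
  exact ⟨Nat.card G, ⟨Nat.card_pos, le_rfl⟩, 1, by simp⟩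

/-- Two families whose inverting permutations have equal signs, and whose generators are told apart
by the number of points moved by their powers, make up a strongly real Beauville structure. -/
theorem isStronglyRealBeauvilleGroup [Finite ι] {N' : Set ℕ} (F : RealPairFamily α ι ε N)
    (F' : RealPairFamily α ι ε N') (hα : 5 ≤ Fintype.card α) (hN : Disjoint N N') :
    IsStronglyRealBeauvilleGroup (ι → alternatingGroup α) := by
  have hB : IsBeauvilleStructure F.fst F.snd F'.fst F'.snd := by
    refine ⟨F.closure_fst_snd hα, F'.closure_fst_snd hα, Set.Subset.antisymm ?_ ?_⟩
    · rintro g ⟨hg, hg'⟩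
      rw [Set.mem_singleton_iff]
      funext i
      by_contra hi
      exact Set.disjoint_left.1 hN (F.card_support_of_mem_beauvilleSigma hg i hi)
        (F'.card_support_of_mem_beauvilleSigma hg' i hi)
    · rw [Set.singleton_subset_iff]
      exact ⟨one_mem_beauvilleSigma _ _, one_mem_beauvilleSigma _ _⟩
  refine ⟨⟨_, _, _, _, hB⟩, _, _, _, _, hB, ?_⟩
  refine ⟨MulEquiv.piCongrRight fun i => MulAut.conjNormal (F.σ i), 1,
    fun i => ⟨F'.σ i * (F.σ i)⁻¹, ?_⟩, ⟨?_, ?_⟩, ?_, ?_⟩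
  · rw [mem_alternatingGroup, map_mul, map_inv, F.sign_σ, F'.sign_σ, mul_inv_cancel]
  · funext i
    ext1
    simpa [fst] using F.inverts_x i
  · funext i
    ext1
    simpa [snd] using F.inverts_y i
  · funext i
    ext1
    simpa [fst, mul_assoc] using F'.inverts_x i
  · funext i
    ext1
    simpa [snd, mul_assoc] using F'.inverts_y i

end RealPairFamily

/-! ### Orbits, blocks and reflections -/

theorem ZMod.intCast_ne_intCast {m : ℕ} {a b : ℤ} (hab : a ≠ b) (h : |a - b| < m) :
    (a : ZMod m) ≠ (b : ZMod m) := by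
  intro he
  rw [← sub_eq_zero, ← Int.cast_sub, ZMod.intCast_zmod_eq_zero_iff_dvd] at he
  exact hab (sub_eq_zero.1 (Int.eq_zero_of_abs_lt_dvd he h))

theorem ZMod.natCast_ne_natCast {m a b : ℕ} (hab : a ≠ b) (ha : a < m) (hb : b < m) :
    (a : ZMod m) ≠ (b : ZMod m) := by
  have := ZMod.intCast_ne_intCast (m := m) (a := a) (b := b) (by omega)
    (by rw [abs_lt]; omega)
  simpa using this

namespace Equiv.Perm

variable {α : Type*}

theorem sameCycle_of_forall_apply_eq {f : Perm α} {g : ℕ → α} {k : ℕ}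
    (h : ∀ i < k, f (g i) = g (i + 1)) : ∀ i ≤ k, f.SameCycle (g 0) (g i) := by
  intro i
  induction i with
  | zero => exact fun _ => SameCycle.refl _ _
  | succ i ih =>
    intro hi
    rw [← h i (by omega), sameCycle_apply_right]
    exact ih (by omega)

theorem SameCycle.pow_apply_eq_self_iff {f : Perm α} {a b : α} (h : f.SameCycle a b) (t : ℕ) :
    (f ^ t) a = a ↔ (f ^ t) b = b := by
  obtain ⟨i, rfl⟩ := h
  have : (f ^ t) ((f ^ i) a) = (f ^ i) ((f ^ t) a) := by
    rw [← mul_apply, ← mul_apply, (Commute.zpow_right (Commute.pow_self f t) i).eq]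
  rw [this, (f ^ i).injective.eq_iff]

/-- Primitivity, spelled out on elements: it suffices to consider blocks through one point, and of
the block property only that an element taking one point of the block into it preserves it. -/
theorem isPreprimitive_of_forall_block {G : Subgroup (Perm α)} {a : α} {g : Perm α} (hg : g ∈ G)
    (hga : g a ≠ a)
    (H : ∀ B : Set α, a ∈ B → (∀ g ∈ G, ∀ b ∈ B, g b ∈ B → ∀ c ∈ B, g c ∈ B) →
      (∃ b ∈ B, b ≠ a) → ∀ z, z ∈ B) :
    MulAction.IsPreprimitive G α := by
  refine MulAction.IsPreprimitive.of_isTrivialBlock_of_notMem_fixedPoints (a := a)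
    (fun h => hga (h ⟨g, hg⟩)) fun B ha hB => ?_
  by_cases hn : ∃ b ∈ B, b ≠ a
  · right
    refine Set.eq_univ_of_forall (H B ha (fun g hg b hb hgb c hc => ?_) hn)
    have := hB.smul_eq_of_mem (g := ⟨g, hg⟩) hb hgb
    rw [← this]
    exact Set.smul_mem_smul_set hc
  · left
    push Not at hn
    exact fun b hb c hc => (hn b hb).trans (hn c hc).symm

variable [Fintype α] [DecidableEq α]

/-- Whether a power of `f` fixes a point depends only on the cycle of that point. -/
theorem card_support_pow_of_two_orbits {f : Perm α} {a b : α} {S : Finset α}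
    (ha : ∀ z ∈ S, f.SameCycle a z) (hb : ∀ z ∉ S, f.SameCycle b z) {t : ℕ} (ht : f ^ t ≠ 1) :
    (f ^ t).support.card = S.card ∨ (f ^ t).support.card = Fintype.card α - S.card ∨
      (f ^ t).support.card = Fintype.card α := by
  by_cases h1 : (f ^ t) a = a
  · by_cases h2 : (f ^ t) b = b
    · refine absurd (Equiv.ext fun z => ?_) ht
      by_cases hz : z ∈ S
      · exact ((ha z hz).pow_apply_eq_self_iff t).1 h1
      · exact ((hb z hz).pow_apply_eq_self_iff t).1 h2
    · right; left
      rw [← Finset.card_compl]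
      congr 1
      ext z
      rw [mem_support, Finset.mem_compl]
      refine ⟨fun h hz => h (((ha z hz).pow_apply_eq_self_iff t).1 h1), fun hz h => ?_⟩
      exact h2 (((hb z hz).pow_apply_eq_self_iff t).2 h)
  · by_cases h2 : (f ^ t) b = b
    · left
      congr 1
      ext z
      rw [mem_support]
      refine ⟨fun h => ?_, fun hz h => h1 (((ha z hz).pow_apply_eq_self_iff t).2 h)⟩
      by_contra hz
      exact h (((hb z hz).pow_apply_eq_self_iff t).1 h2)
    · right; right
      rw [← Finset.card_univ]
      congr 1
      ext z
      simp only [mem_support, Finset.mem_univ, iff_true]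
      intro h
      by_cases hz : z ∈ S
      · exact h1 (((ha z hz).pow_apply_eq_self_iff t).2 h)
      · exact h2 (((hb z hz).pow_apply_eq_self_iff t).2 h)

theorem IsCycle.support_pow_eq {f : Perm α} (hf : f.IsCycle) {t : ℕ} (ht : f ^ t ≠ 1) :
    (f ^ t).support = f.support := by
  refine le_antisymm (support_pow_le f t) fun z hz => ?_
  rw [mem_support] at hz ⊢
  exact fun h => ht (hf.pow_eq_one_iff.2 ⟨z, hz, h⟩)

end Equiv.Perm

theorem sign_addRight_one (m : ℕ) [NeZero m] :
    sign (Equiv.addRight (1 : ZMod m)) = (-1) ^ (m - 1) := by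
  obtain ⟨k, rfl⟩ := Nat.exists_eq_succ_of_ne_zero (NeZero.ne m)
  rw [← sign_finRotate]
  congr 1
  ext i : 1
  exact (finRotate_apply i).symm

theorem sign_subLeft_of_odd {m j : ℕ} [NeZero m] (hm : Even m) (hj : Odd j) :
    sign (Equiv.subLeft (j : ZMod m)) = (-1) ^ (m / 2) := by
  rw [sign_of_pow_two_eq_one (by ext z : 1; simp [sq])]
  have : IsEmpty (Function.fixedPoints (Equiv.subLeft (j : ZMod m))) := by
    refine ⟨fun ⟨z, hz⟩ => ?_⟩
    have h1 : (j : ZMod m) - z = z := hz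
    have h2 := congrArg (ZMod.castHom hm.two_dvd (ZMod 2)) (sub_eq_iff_eq_add.1 h1)
    rw [map_natCast, map_add, CharTwo.add_self_eq_zero, ZMod.natCast_eq_zero_iff_even] at h2
    exact Nat.not_even_iff_odd.2 hj h2
  rw [Fintype.card_eq_zero (α := Function.fixedPoints _), ZMod.card, Nat.sub_zero]

theorem sign_subLeft_neg_one {q : ℕ} :
    sign (Equiv.subLeft (-1 : ZMod (2 * q + 1))) = (-1) ^ q := by
  rw [sign_of_pow_two_eq_one (by ext z : 1; simp [sq])]
  have hq : (2 : ZMod (2 * q + 1)) * q + 1 = 0 := by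
    exact_mod_cast ZMod.natCast_self (2 * q + 1)
  have : Fintype.card (Function.fixedPoints (Equiv.subLeft (-1 : ZMod (2 * q + 1)))) = 1 := by
    rw [Fintype.card_eq_one_iff]
    refine ⟨⟨q, ?_⟩, fun ⟨z, hz⟩ => Subtype.ext ?_⟩
    · change (-1 : ZMod (2 * q + 1)) - q = q
      linear_combination -hq
    · have h1 : (-1 : ZMod (2 * q + 1)) - z = z := hz
      -- `q + 1` is the inverse of `2`
      linear_combination (q + 1 : ZMod (2 * q + 1)) * (-h1) + (-(z + 1)) * hq
  rw [this, ZMod.card]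
  congr 1
  omega

/-! ### Two rotations joined by a 3-cycle -/

theorem Equiv.swap_mul_swap_apply_of_ne {α : Type*} [DecidableEq α] {a b c z : α} (ha : z ≠ a)
    (hb : z ≠ b) (hc : z ≠ c) : (swap a b * swap a c) z = z := by
  rw [Perm.mul_apply, swap_apply_of_ne_of_ne ha hc, swap_apply_of_ne_of_ne ha hb]

namespace JoinedRotations

/-- The rotation of both summands of `ZMod m ⊕ ZMod 2`. -/
def rot (m : ℕ) : Perm (ZMod m ⊕ ZMod 2) :=
  Equiv.sumCongr (Equiv.addRight 1) (Equiv.addRight 1)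

/-- The 3-cycle `inr 0 ↦ inl 0 ↦ inl j ↦ inr 0`. -/
def tri (m j : ℕ) : Perm (ZMod m ⊕ ZMod 2) :=
  swap (Sum.inr 0) (Sum.inl (j : ZMod m)) * swap (Sum.inr 0) (Sum.inl 0)

/-- The reflection `z ↦ j - z` of `ZMod m`, fixing both points of `ZMod 2`. -/
def refl (m j : ℕ) : Perm (ZMod m ⊕ ZMod 2) :=
  Equiv.sumCongr (Equiv.subLeft (j : ZMod m)) (Equiv.refl (ZMod 2))

variable {m j : ℕ}

theorem rot_inl (z : ZMod m) : rot m (Sum.inl z) = Sum.inl (z + 1) := rfl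

theorem rot_inr (z : ZMod 2) : rot m (Sum.inr z) = Sum.inr (z + 1) := rfl

theorem rot_pow_inl (t : ℕ) (z : ZMod m) : (rot m ^ t) (Sum.inl z) = Sum.inl (z + t) := by
  induction t with
  | zero => simp
  | succ t ih => rw [pow_succ', Perm.mul_apply, ih, rot_inl]; push_cast; rw [add_assoc]

theorem rot_pow_inr (t : ℕ) (z : ZMod 2) : (rot m ^ t) (Sum.inr z) = Sum.inr (z + t) := by
  induction t with
  | zero => simp
  | succ t ih => rw [pow_succ', Perm.mul_apply, ih, rot_inr]; push_cast; rw [add_assoc]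

theorem tri_inr_zero (hj : (j : ZMod m) ≠ 0) : tri m j (Sum.inr 0) = Sum.inl 0 := by
  rw [tri, Perm.mul_apply, swap_apply_left,
    swap_apply_of_ne_of_ne (by simp) (by simpa using hj.symm)]

theorem tri_inl_zero : tri m j (Sum.inl 0) = Sum.inl (j : ZMod m) := by
  rw [tri, Perm.mul_apply, swap_apply_right, swap_apply_left]

theorem tri_inl_self (hj : (j : ZMod m) ≠ 0) : tri m j (Sum.inl (j : ZMod m)) = Sum.inr 0 := by
  have h : swap (Sum.inr 0) (Sum.inl 0) (Sum.inl (j : ZMod m)) =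
      (Sum.inl (j : ZMod m) : ZMod m ⊕ ZMod 2) :=
    swap_apply_of_ne_of_ne (by simp) (by simpa using hj)
  rw [tri, Perm.mul_apply, h, swap_apply_right]

theorem tri_inr_one : tri m j (Sum.inr 1) = Sum.inr 1 :=
  swap_mul_swap_apply_of_ne (by simp) (by simp) (by simp)

theorem tri_inl_of_ne {z : ZMod m} (h0 : z ≠ 0) (hj : z ≠ j) :
    tri m j (Sum.inl z) = Sum.inl z :=
  swap_mul_swap_apply_of_ne (by simp) (by simpa using hj) (by simpa using h0)

theorem isThreeCycle_tri (hj : (j : ZMod m) ≠ 0) [NeZero m] : (tri m j).IsThreeCycle :=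
  isThreeCycle_swap_mul_swap_same (by simp) (by simp) (by simpa using hj)

theorem sign_rot [NeZero m] (hm : Even m) : sign (rot m) = 1 := by
  have h2 : sign (Equiv.addRight (1 : ZMod 2)) = -1 := sign_addRight_one 2
  have h3 : Odd (m - 1) := by
    have := NeZero.ne m
    obtain ⟨q, rfl⟩ := hm
    exact ⟨q - 1, by omega⟩
  rw [rot, sign_sumCongr, sign_addRight_one, h2, h3.neg_one_pow]
  rfl

theorem sign_refl [NeZero m] (hm : Even m) (hj : Odd j) :
    sign (refl m j) = (-1) ^ (m / 2) := by
  rw [refl, sign_sumCongr, sign_subLeft_of_odd hm hj, Equiv.Perm.sign_refl, mul_one]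

theorem refl_conj_rot : refl m j * rot m * (refl m j)⁻¹ = (rot m)⁻¹ := by
  rw [mul_inv_eq_iff_eq_mul, eq_inv_mul_iff_mul_eq]
  ext z : 1
  obtain z | z := z
  · change Sum.inl ((j : ZMod m) - (z + 1) + 1) = Sum.inl ((j : ZMod m) - z)
    congr 1
    ring
  · change Sum.inr (z + 1 + 1) = Sum.inr z
    rw [add_assoc, CharTwo.add_self_eq_zero, add_zero]

theorem refl_conj_tri : refl m j * tri m j * (refl m j)⁻¹ = (tri m j)⁻¹ := by
  have h : refl m j * tri m j * (refl m j)⁻¹ =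
      refl m j * swap (Sum.inr 0) (Sum.inl (j : ZMod m)) * (refl m j)⁻¹ *
      (refl m j * swap (Sum.inr 0) (Sum.inl 0) * (refl m j)⁻¹) := by
    rw [tri]; group
  have h0 : refl m j (Sum.inr 0) = Sum.inr 0 := rfl
  have h1 : refl m j (Sum.inl (j : ZMod m)) = Sum.inl 0 := congrArg Sum.inl (sub_self _)
  have h2 : refl m j (Sum.inl 0) = Sum.inl (j : ZMod m) := congrArg Sum.inl (sub_zero _)
  rw [h, ← swap_apply_apply, ← swap_apply_apply, h0, h1, h2, tri, mul_inv_rev, swap_inv, swap_inv]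

theorem card_support_rot_pow [NeZero m] {t : ℕ} (ht : rot m ^ t ≠ 1) :
    (rot m ^ t).support.card = m ∨ (rot m ^ t).support.card = 2 ∨
      (rot m ^ t).support.card = m + 2 := by
  have h := card_support_pow_of_two_orbits (f := rot m) (a := Sum.inl 0) (b := Sum.inr 0)
    (S := Finset.univ.map Function.Embedding.inl) ?_ ?_ ht
  · simpa [ZMod.card] using h
  · intro z hz
    obtain ⟨z, -, rfl⟩ := Finset.mem_map.1 hz
    refine ⟨z.val, ?_⟩
    rw [zpow_natCast, rot_pow_inl, zero_add, ZMod.natCast_zmod_val]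
    rfl
  · rintro (z | z) hz
    · exact absurd (Finset.mem_map.2 ⟨z, Finset.mem_univ _, rfl⟩) hz
    · refine ⟨z.val, ?_⟩
      rw [zpow_natCast, rot_pow_inr, zero_add, ZMod.natCast_zmod_val]

/-- The product has the two cycles `inl 1 ↦ ⋯ ↦ inl j ↦ inr 1 ↦ inr 0` and
`inl (j + 1) ↦ ⋯ ↦ inl (m - 1) ↦ inl 0`. -/
theorem card_support_rot_mul_tri_pow [NeZero m] (hj0 : 0 < j) (hjm : j < m) {t : ℕ}
    (ht : (rot m * tri m j) ^ t ≠ 1) :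
    ((rot m * tri m j) ^ t).support.card = j + 2 ∨
      ((rot m * tri m j) ^ t).support.card = m - j ∨
      ((rot m * tri m j) ^ t).support.card = m + 2 := by
  have hne : ∀ i : ℕ, 0 < i → i < m → (i : ZMod m) ≠ 0 := fun i h0 hi => by
    simpa using ZMod.natCast_ne_natCast (b := 0) h0.ne' hi (by omega)
  have hj := hne j hj0 hjm
  let S : Finset (ZMod m ⊕ ZMod 2) :=
    (Finset.Icc 1 j).image (fun i : ℕ => Sum.inl (i : ZMod m)) ∪
      Finset.univ.map Function.Embedding.inr
  have hS : S.card = j + 2 := by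
    rw [Finset.card_union_of_disjoint, Finset.card_image_of_injOn]
    · simp
    · intro a ha b hb hab
      simp only [Finset.coe_Icc, Set.mem_Icc] at ha hb
      by_contra hn
      exact ZMod.natCast_ne_natCast hn (by omega) (by omega) (Sum.inl_injective hab)
    · simp [Finset.disjoint_left]
  have step : ∀ i : ℕ, 0 < i → i < m → i ≠ j →
      (rot m * tri m j) (Sum.inl (i : ZMod m)) = Sum.inl ((i + 1 : ℕ) : ZMod m) := by
    intro i h0 hi hij
    rw [Perm.mul_apply, tri_inl_of_ne (hne i h0 hi) (ZMod.natCast_ne_natCast hij hi hjm), rot_inl,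
      Nat.cast_succ]
  have h1 := sameCycle_of_forall_apply_eq (f := rot m * tri m j)
    (g := fun i => Sum.inl ((i + 1 : ℕ) : ZMod m)) (k := j - 1)
    fun i hi => step (i + 1) (by omega) (by omega) (by omega)
  have h2 := sameCycle_of_forall_apply_eq (f := rot m * tri m j)
    (g := fun i => Sum.inl ((j + 1 + i : ℕ) : ZMod m)) (k := m - (j + 1))
    fun i hi => step (j + 1 + i) (by omega) (by omega) (by omega)
  have h3 : (rot m * tri m j).SameCycle (Sum.inl ((0 + 1 : ℕ) : ZMod m)) (Sum.inr 1) := by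
    have := sameCycle_apply_right.2 (h1 (j - 1) le_rfl)
    rwa [Nat.sub_add_cancel hj0, Perm.mul_apply, tri_inl_self hj, rot_inr, zero_add] at this
  have h := card_support_pow_of_two_orbits (f := rot m * tri m j)
    (a := Sum.inl ((0 + 1 : ℕ) : ZMod m)) (b := Sum.inl ((j + 1 + 0 : ℕ) : ZMod m))
    (S := S) ?_ ?_ ht
  · have : Fintype.card (ZMod m ⊕ ZMod 2) = m + 2 := by simp [ZMod.card]
    rw [this, hS] at h
    rwa [show m + 2 - (j + 2) = m - j by omega] at h
  · intro z hz
    obtain hz | hz := Finset.mem_union.1 hz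
    · obtain ⟨i, hi, rfl⟩ := Finset.mem_image.1 hz
      rw [Finset.mem_Icc] at hi
      have := h1 (i - 1) (by omega)
      rwa [Nat.sub_add_cancel hi.1] at this
    · obtain ⟨z, -, rfl⟩ := Finset.mem_map.1 hz
      have h4 := sameCycle_apply_right.2 h3
      rw [Perm.mul_apply, tri_inr_one, rot_inr] at h4
      fin_cases z
      · exact h4
      · exact h3
  · rintro (z | z) hz
    · obtain ⟨i, hi, rfl⟩ : ∃ i < m, (i : ZMod m) = z :=
        ⟨z.val, z.val_lt, ZMod.natCast_zmod_val z⟩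
      obtain rfl | hi0 := Nat.eq_zero_or_pos i
      · have := h2 (m - (j + 1)) le_rfl
        rw [Nat.add_sub_cancel' (by omega), ZMod.natCast_self] at this
        simpa using this
      · have hij : j < i := by
          by_contra! hij
          exact hz (Finset.mem_union_left _ (Finset.mem_image.2
            ⟨i, Finset.mem_Icc.2 ⟨hi0, hij⟩, rfl⟩))
        have := h2 (i - (j + 1)) (by omega)
        rwa [Nat.add_sub_cancel' (by omega)] at this
    · exact absurd (Finset.mem_union_right _ (Finset.mem_map.2 ⟨z, Finset.mem_univ _, rfl⟩)) hz

/-- For odd `j` the group generated by the rotation and the 3-cycle is primitive. A block through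
`inr 0` is stable under the square of the rotation; if it is not a singleton, it contains a fixed
point of the 3-cycle, hence `inl 0` and `inl j`, which represent both classes modulo `2`. -/
theorem alternatingGroup_le_closure [NeZero m] (hm : Even m) (hj : Odd j) (hm4 : 4 < m) :
    alternatingGroup (ZMod m ⊕ ZMod 2) ≤ Subgroup.closure {rot m, tri m j} := by
  have hne : ∀ z : ZMod m, z + z ≠ (j : ZMod m) := fun z hz => by
    have h2 := congrArg (ZMod.castHom hm.two_dvd (ZMod 2)) hz
    rw [map_natCast, map_add, CharTwo.add_self_eq_zero, eq_comm,
      ZMod.natCast_eq_zero_iff_even] at h2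
    exact Nat.not_even_iff_odd.2 hj h2
  have hj0 : (j : ZMod m) ≠ 0 := fun h => hne 0 (by rw [h, add_zero])
  have hmem_rot : rot m ∈ Subgroup.closure {rot m, tri m j} := Subgroup.subset_closure (by simp)
  have hmem_tri : tri m j ∈ Subgroup.closure {rot m, tri m j} := Subgroup.subset_closure (by simp)
  refine alternatingGroup_le_of_isPreprimitive_of_isThreeCycle_mem ?_ (isThreeCycle_tri hj0)
    hmem_tri
  refine isPreprimitive_of_forall_block (a := Sum.inr 0) hmem_tri (by simp [tri_inr_zero hj0]) ?_
  intro B h0 hB ⟨b, hb, hb0⟩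
  have shift : ∀ (t : ℕ) (z : ZMod m), Sum.inl z ∈ B →
      Sum.inl (z + ((2 * t : ℕ) : ZMod m)) ∈ B := by
    intro t z hz
    have := hB (rot m ^ (2 * t)) (pow_mem hmem_rot _) (Sum.inr 0) h0
      (by rwa [rot_pow_inr, zero_add, (ZMod.natCast_eq_zero_iff_even).2 (even_two_mul t)]) _ hz
    rwa [rot_pow_inl] at this
  have full : Sum.inl 0 ∈ B → Sum.inl (j : ZMod m) ∈ B → ∀ z, z ∈ B := by
    intro hz hzj
    have hl : ∀ z : ZMod m, Sum.inl z ∈ B := by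
      intro z
      rw [← ZMod.natCast_zmod_val z]
      obtain he | ho := Nat.even_or_odd z.val
      · have := shift (z.val / 2) _ hz
        rwa [Nat.two_mul_div_two_of_even he, zero_add] at this
      · -- adding a multiple of `m` makes the difference from `j` nonnegative
        obtain ⟨q, hq⟩ : Even (z.val + j * m - j) := by
          have h1 : Even (j * m) := hm.mul_left j
          have h2 : j ≤ j * m := Nat.le_mul_of_pos_right j (by omega)
          rw [Nat.even_sub (by omega), Nat.even_add]
          simp [h1, Nat.not_even_iff_odd.2 ho, Nat.not_even_iff_odd.2 hj]
        have h2 : j ≤ j * m := Nat.le_mul_of_pos_right j (by omega)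
        have := shift q _ hzj
        rw [← Nat.cast_add, show j + 2 * q = z.val + j * m by omega] at this
        simpa using this
    have hr := hB (rot m) hmem_rot (Sum.inl 0) (hl 0) (by rw [rot_inl]; exact hl _) _ h0
    rintro (z | z)
    · exact hl z
    · fin_cases z
      · exact h0
      · exact hr
  -- a point of the block fixed by the 3-cycle
  have fixed : ∀ b ∈ B, tri m j b = b → ∀ z, z ∈ B := by
    intro b hb hfix
    have hc := hB (tri m j) hmem_tri b hb (by rwa [hfix])
    have h1 := hc _ h0
    rw [tri_inr_zero hj0] at h1
    have h2 := hc _ h1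
    rw [tri_inl_zero] at h2
    exact full h1 h2
  obtain z | z := b
  · by_cases hz : z = 0 ∨ z = j
    · -- then `z + 2` is fixed by the 3-cycle, as `j` is odd
      have h2 : (2 : ZMod m) ≠ 0 := by
        simpa using ZMod.natCast_ne_natCast (m := m) (a := 2) (b := 0) (by omega) (by omega)
          (by omega)
      have h3 := shift 1 z hb
      refine fixed _ h3 (tri_inl_of_ne ?_ ?_)
      · obtain rfl | rfl := hz
        · simpa using h2
        · intro h
          apply hne (-1)
          push_cast at h
          linear_combination -h
      · obtain rfl | rfl := hz
        · intro h
          apply hne 1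
          push_cast at h
          linear_combination h
        · simpa using h2
    · rw [not_or] at hz
      exact fixed _ hb (tri_inl_of_ne hz.1 hz.2)
  · fin_cases z
    · exact absurd rfl hb0
    · exact fixed _ hb tri_inr_one

theorem conj_tri (t : ℕ) (ht : Odd t) :
    rot m ^ t * tri m j * (rot m ^ t)⁻¹ =
      swap (Sum.inr 1) (Sum.inl ((j + t : ℕ) : ZMod m)) *
        swap (Sum.inr 1) (Sum.inl (t : ZMod m)) := by
  have h : rot m ^ t * tri m j * (rot m ^ t)⁻¹ =
      rot m ^ t * swap (Sum.inr 0) (Sum.inl (j : ZMod m)) * (rot m ^ t)⁻¹ *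
      (rot m ^ t * swap (Sum.inr 0) (Sum.inl 0) * (rot m ^ t)⁻¹) := by
    rw [tri]; group
  have h2 : (t : ZMod 2) = 1 := ZMod.natCast_eq_one_iff_odd.2 ht
  rw [h, ← swap_apply_apply, ← swap_apply_apply, rot_pow_inr, rot_pow_inl, rot_pow_inl, h2,
    zero_add, zero_add, Nat.cast_add]

theorem commute_conj_tri_of_ne {t : ℕ} (ht : Odd t) (hj0 : 0 < j) (htj : t ≠ j)
    (hm : j + t < m) : Commute (tri m j) (rot m ^ t * tri m j * (rot m ^ t)⁻¹) := by
  have ht0 := ht.pos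
  have hne : ∀ {a b : ℕ}, a ≠ b → a < m → b < m → (Sum.inl (a : ZMod m) : ZMod m ⊕ ZMod 2) ≠
      Sum.inl (b : ZMod m) := fun hab ha hb h =>
    ZMod.natCast_ne_natCast hab ha hb (Sum.inl_injective h)
  apply Equiv.Perm.Disjoint.commute
  rw [conj_tri t ht]
  intro z
  by_cases h1 : z = Sum.inr 0
  · right
    subst h1
    exact swap_mul_swap_apply_of_ne (by simp) (by simp) (by simp)
  by_cases h2 : z = Sum.inl ((0 : ℕ) : ZMod m)
  · right
    subst h2
    exact swap_mul_swap_apply_of_ne (by simp) (hne (by omega) (by omega) (by omega))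
      (hne (by omega) (by omega) (by omega))
  by_cases h3 : z = Sum.inl (j : ZMod m)
  · right
    subst h3
    exact swap_mul_swap_apply_of_ne (by simp) (hne (by omega) (by omega) (by omega))
      (hne (by omega) (by omega) (by omega))
  · left
    rw [Nat.cast_zero] at h2
    exact swap_mul_swap_apply_of_ne h1 h3 h2

theorem not_commute_conj_tri (hj : Odd j) (hm : j + j < m) :
    ¬ Commute (tri m j) (rot m ^ j * tri m j * (rot m ^ j)⁻¹) := by
  have hj0 := hj.pos
  have hne : ∀ {a b : ℕ}, a ≠ b → a < m → b < m → (Sum.inl (a : ZMod m) : ZMod m ⊕ ZMod 2) ≠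
      Sum.inl (b : ZMod m) := fun hab ha hb h =>
    ZMod.natCast_ne_natCast hab ha hb (Sum.inl_injective h)
  intro h
  have h1 := congrArg (fun f => f (Sum.inl ((0 : ℕ) : ZMod m))) h.eq
  simp only [conj_tri j hj, Perm.mul_apply] at h1
  have h2 := swap_mul_swap_apply_of_ne (a := Sum.inr 1)
    (b := Sum.inl ((j + j : ℕ) : ZMod m)) (c := Sum.inl (j : ZMod m))
    (z := Sum.inl ((0 : ℕ) : ZMod m)) (by simp) (hne (by omega) (by omega) (by omega))
    (hne (by omega) (by omega) (by omega))
  rw [Perm.mul_apply] at h2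
  rw [h2, Nat.cast_zero, tri_inl_zero, swap_apply_right, swap_apply_left] at h1
  exact hne (by omega) (by omega) (by omega) h1

/-- The family of pairs consisting of the rotation and the 3-cycle with parameter `j i`, for
distinct odd numbers `j i`. The bounds on `j i` make sure that no power of the product moves
exactly `5` or exactly `m + 1` points. -/
def family {ι : Type*} {m : ℕ} [NeZero m] (hm : Even m) (hm8 : 8 ≤ m) (j : ι → ℕ)
    (hinj : Function.Injective j) (hj : ∀ i, Odd (j i)) (hj3 : ∀ i, j i ≠ 3)
    (hjm : ∀ i, j i + 5 < m) (hjj : ∀ i l, j i + j l < m) :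
    RealPairFamily (ZMod m ⊕ ZMod 2) ι ((-1) ^ (m / 2)) {5, m + 1}ᶜ where
  x _ := rot m
  y i := tri m (j i)
  σ i := refl m (j i)
  sign_x _ := sign_rot hm
  sign_y i := by
    have hj0 := (hj i).pos
    have := hjm i
    exact (isThreeCycle_tri (by
      simpa using ZMod.natCast_ne_natCast (m := m) (b := 0) hj0.ne' (by omega) (by omega))).sign
  sign_σ i := sign_refl hm (hj i)
  alternatingGroup_le i := alternatingGroup_le_closure hm (hj i) (by omega)
  separated i l hil := by
    let c := FreeGroup.of false
    let d := FreeGroup.of true ^ j l * FreeGroup.of false * (FreeGroup.of true ^ j l)⁻¹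
    have key : ∀ q, FreeGroup.lift (fun b => cond b (rot m) (tri m (j q)))
        (c * d * (d * c)⁻¹) = 1 ↔
        Commute (tri m (j q)) (rot m ^ j l * tri m (j q) * (rot m ^ j l)⁻¹) := by
      intro q
      rw [map_mul, map_inv, mul_inv_eq_one]
      simp only [c, d, map_mul, map_inv, map_pow, FreeGroup.lift_apply_of, cond_true, cond_false]
      rfl
    refine ⟨c * d * (d * c)⁻¹, ?_, ?_⟩
    · rw [key]
      exact commute_conj_tri_of_ne (hj l) (hj i).pos (fun h => hil (hinj h.symm)) (hjj i l)
    · rw [Ne, key]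
      exact not_commute_conj_tri (hj l) (hjj l l)
  inverts_x _ := refl_conj_rot
  inverts_y _ := refl_conj_tri
  card_support_x i t ht := by
    have := card_support_rot_pow ht
    rw [Set.mem_compl_iff, Set.mem_insert_iff, Set.mem_singleton_iff]
    omega
  card_support_y i t ht := by
    have hj0 := (hj i).pos
    have := hjm i
    have h3 := isThreeCycle_tri (m := m) (j := j i) (by
      simpa using ZMod.natCast_ne_natCast (m := m) (b := 0) hj0.ne' (by omega) (by omega))
    rw [h3.isCycle.support_pow_eq ht, h3.card_support, Set.mem_compl_iff, Set.mem_insert_iff,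
      Set.mem_singleton_iff]
    omega
  card_support_mul i t ht := by
    have h1 := hjm i
    have h3 := hj3 i
    have := card_support_rot_mul_tri_pow (hj i).pos (by omega) ht
    rw [Set.mem_compl_iff, Set.mem_insert_iff, Set.mem_singleton_iff]
    omega

end JoinedRotations

/-! ### A rotation with a fixed point and a 5-cycle -/

/-- The cyclic permutation `a ↦ b ↦ c ↦ d ↦ e ↦ a` (for distinct points). -/
def fiveCycle {α : Type*} [DecidableEq α] (a b c d e : α) : Perm α :=
  swap a b * (swap b c * (swap c d * swap d e))

namespace fiveCycle

variable {α β : Type*} [DecidableEq α] [DecidableEq β]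

theorem _root_.Equiv.Perm.viaEmbeddingHom_swap (ι : α ↪ β) (a b : α) :
    viaEmbeddingHom ι (swap a b) = swap (ι a) (ι b) := by
  ext z : 1
  rw [viaEmbeddingHom_apply]
  by_cases hz : z ∈ Set.range ι
  · obtain ⟨z, rfl⟩ := hz
    rw [viaEmbedding_apply, ι.injective.swap_apply]
  · rw [viaEmbedding_apply_of_notMem _ _ _ hz, swap_apply_of_ne_of_ne]
    · rintro rfl; exact hz ⟨_, rfl⟩
    · rintro rfl; exact hz ⟨_, rfl⟩

theorem map_viaEmbeddingHom (ι : α ↪ β) (a b c d e : α) :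
    viaEmbeddingHom ι (fiveCycle a b c d e) = fiveCycle (ι a) (ι b) (ι c) (ι d) (ι e) := by
  simp only [fiveCycle, map_mul, viaEmbeddingHom_swap]

theorem conj (g : Perm α) (a b c d e : α) :
    g * fiveCycle a b c d e * g⁻¹ = fiveCycle (g a) (g b) (g c) (g d) (g e) := by
  simp only [fiveCycle, swap_apply_apply]
  group

/-- The enumeration of the entries of a list without repetitions, an embedding along
which identities between explicit permutations are transported. -/
def ofNodup (l : List α) (hl : l.Nodup) : Fin l.length ↪ α :=
  ⟨l.get, List.nodup_iff_injective_get.1 hl⟩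

theorem inv {a b c d e : α} (h : [a, b, c, d, e].Nodup) :
    (fiveCycle a b c d e)⁻¹ = fiveCycle a e d c b := by
  have h1 : (fiveCycle 0 1 2 3 4 : Perm (Fin 5))⁻¹ = fiveCycle 0 4 3 2 1 := by decide
  have h2 := congrArg (viaEmbeddingHom (ofNodup _ h)) h1
  rw [map_inv] at h2
  erw [map_viaEmbeddingHom, map_viaEmbeddingHom] at h2
  exact h2

theorem eq_formPerm (a b c d e : α) : fiveCycle a b c d e = List.formPerm [a, b, c, d, e] := by
  simp [fiveCycle]

theorem isCycle {a b c d e : α} (h : [a, b, c, d, e].Nodup) : (fiveCycle a b c d e).IsCycle := by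
  rw [eq_formPerm]
  exact List.isCycle_formPerm h (by simp)

theorem card_support [Fintype α] {a b c d e : α} (h : [a, b, c, d, e].Nodup) :
    (fiveCycle a b c d e).support.card = 5 := by
  rw [eq_formPerm, List.support_formPerm_of_nodup _ h (by simp), List.toFinset_card_of_nodup h]
  rfl

theorem apply_of_notMem {a b c d e z : α} (h : z ∉ [a, b, c, d, e]) :
    fiveCycle a b c d e z = z := by
  rw [eq_formPerm]
  exact List.formPerm_apply_of_notMem h

theorem apply {a b c d e : α} (h : [a, b, c, d, e].Nodup) :
    fiveCycle a b c d e a = b ∧ fiveCycle a b c d e b = c ∧ fiveCycle a b c d e c = d ∧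
      fiveCycle a b c d e d = e ∧ fiveCycle a b c d e e = a := by
  have key : ∀ i : Fin 5, fiveCycle a b c d e (ofNodup _ h i) =
      ofNodup _ h ((fiveCycle 0 1 2 3 4 : Perm (Fin 5)) i) := by
    intro i
    have := map_viaEmbeddingHom (ofNodup _ h) (0 : Fin 5) 1 2 3 4
    exact (DFunLike.congr_fun this.symm _).trans (viaEmbedding_apply _ _ _)
  have h0 : (fiveCycle 0 1 2 3 4 : Perm (Fin 5)) 0 = 1 := by decide
  have h1 : (fiveCycle 0 1 2 3 4 : Perm (Fin 5)) 1 = 2 := by decide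
  have h2 : (fiveCycle 0 1 2 3 4 : Perm (Fin 5)) 2 = 3 := by decide
  have h3 : (fiveCycle 0 1 2 3 4 : Perm (Fin 5)) 3 = 4 := by decide
  have h4 : (fiveCycle 0 1 2 3 4 : Perm (Fin 5)) 4 = 0 := by decide
  refine ⟨?_, ?_, ?_, ?_, ?_⟩
  · exact (key 0).trans (congrArg _ h0)
  · exact (key 1).trans (congrArg _ h1)
  · exact (key 2).trans (congrArg _ h2)
  · exact (key 3).trans (congrArg _ h3)
  · exact (key 4).trans (congrArg _ h4)

/-- Two 5-cycles with exactly one common point have a 3-cycle as their commutator. -/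
theorem isThreeCycle_commutator [Fintype α] {p a b c d a' b' c' d' : α}
    (h : [p, a, b, c, d, a', b', c', d'].Nodup) :
    (fiveCycle p a b c d * fiveCycle p a' b' c' d' * (fiveCycle p a b c d)⁻¹ *
      (fiveCycle p a' b' c' d')⁻¹).IsThreeCycle := by
  have h1 : (fiveCycle 0 1 2 3 4 * fiveCycle 0 5 6 7 8 * (fiveCycle 0 1 2 3 4)⁻¹ *
      (fiveCycle 0 5 6 7 8)⁻¹ : Perm (Fin 9)) = swap 0 5 * swap 0 1 := by decide
  have h2 := congrArg (viaEmbeddingHom (ofNodup _ h)) h1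
  simp only [map_mul, map_inv] at h2
  erw [map_viaEmbeddingHom, map_viaEmbeddingHom, viaEmbeddingHom_swap, viaEmbeddingHom_swap] at h2
  erw [h2]
  have hne : ∀ {i j : Fin 9}, i ≠ j → ofNodup _ h i ≠ ofNodup _ h j :=
    fun hij => (ofNodup _ h).injective.ne hij
  exact isThreeCycle_swap_mul_swap_same (hne (by decide)) (hne (by decide)) (hne (by decide))

/-- The fourth power of `y * y'⁻¹`, for 5-cycles `y` and `y'`, depends on how they overlap: it is
nontrivial if they have only one common point. -/
theorem mul_inv_pow_four_ne_one {p a b c d a' b' c' d' : α}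
    (h : [p, a, b, c, d, a', b', c', d'].Nodup) :
    (fiveCycle p a b c d * (fiveCycle p a' b' c' d')⁻¹) ^ 4 ≠ 1 := by
  have h1 : (fiveCycle 0 1 2 3 4 * (fiveCycle 0 5 6 7 8)⁻¹ : Perm (Fin 9)) ^ 4 ≠ 1 := by
    decide +kernel
  have h2 := (viaEmbeddingHom_injective (ofNodup _ h)).ne h1
  rw [map_pow, map_mul, map_inv, map_one] at h2
  erw [map_viaEmbeddingHom, map_viaEmbeddingHom] at h2
  exact h2

/-- Here the last point of the first cycle is the first point of the second one after `p`. -/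
theorem mul_inv_pow_four_eq_one {p a b c d b' c' d' : α}
    (h : [p, a, b, c, d, b', c', d'].Nodup) :
    (fiveCycle p a b c d * (fiveCycle p d b' c' d')⁻¹) ^ 4 = 1 := by
  have h1 : (fiveCycle 0 1 2 3 4 * (fiveCycle 0 4 5 6 7)⁻¹ : Perm (Fin 8)) ^ 4 = 1 := by
    decide +kernel
  have h2 := congrArg (viaEmbeddingHom (ofNodup _ h)) h1
  rw [map_pow, map_mul, map_inv, map_one] at h2
  erw [map_viaEmbeddingHom, map_viaEmbeddingHom] at h2
  exact h2

/-- Here the first and the third point of the second cycle after `p` are the second and the fourth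
point of the first one. -/
theorem mul_inv_pow_four_ne_one' {p a b c d b' d' : α} (h : [p, a, b, c, d, b', d'].Nodup) :
    (fiveCycle p a b c d * (fiveCycle p b b' d d')⁻¹) ^ 4 ≠ 1 := by
  have h1 : (fiveCycle 0 1 2 3 4 * (fiveCycle 0 2 5 4 6)⁻¹ : Perm (Fin 7)) ^ 4 ≠ 1 := by
    decide +kernel
  have h2 := (viaEmbeddingHom_injective (ofNodup _ h)).ne h1
  rw [map_pow, map_mul, map_inv, map_one] at h2
  erw [map_viaEmbeddingHom, map_viaEmbeddingHom] at h2
  exact h2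

/-- Here the first two points of the second cycle after `p` are the last two points of the first
one. -/
theorem mul_inv_pow_four_ne_one'' {p a b c d c' d' : α} (h : [p, a, b, c, d, c', d'].Nodup) :
    (fiveCycle p a b c d * (fiveCycle p c d c' d')⁻¹) ^ 4 ≠ 1 := by
  have h1 : (fiveCycle 0 1 2 3 4 * (fiveCycle 0 3 4 5 6)⁻¹ : Perm (Fin 7)) ^ 4 ≠ 1 := by
    decide +kernel
  have h2 := (viaEmbeddingHom_injective (ofNodup _ h)).ne h1
  rw [map_pow, map_mul, map_inv, map_one] at h2
  erw [map_viaEmbeddingHom, map_viaEmbeddingHom] at h2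
  exact h2

end fiveCycle

namespace PointedRotation

/-- The rotation of `ZMod m`, fixing the additional point `none`. -/
def rot (m : ℕ) : Perm (Option (ZMod m)) := optionCongr (Equiv.addRight 1)

/-- The point of `ZMod m` represented by an integer. -/
def pt (m : ℕ) (z : ℤ) : Option (ZMod m) := some (z : ZMod m)

/-- The 5-cycle through `none` and the points `-(r + 1)`, `0`, `-1`, `r`, a set of points which is
stable under the reflection `z ↦ -1 - z`. -/
def pent (m r : ℕ) : Perm (Option (ZMod m)) :=
  fiveCycle none (pt m (-(r + 1))) (pt m 0) (pt m (-1)) (pt m r)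

/-- The reflection `z ↦ -1 - z` of `ZMod m`, fixing the additional point `none`. -/
def refl (m : ℕ) : Perm (Option (ZMod m)) := optionCongr (Equiv.subLeft (-1))

variable {m r : ℕ}

theorem pt_ne_pt {a b : ℤ} (hab : a ≠ b) (h1 : a - b < m) (h2 : b - a < m) : pt m a ≠ pt m b :=
  fun h => ZMod.intCast_ne_intCast hab (by rw [abs_lt]; omega) (Option.some_injective _ h)

theorem pt_add_self (z : ℤ) : pt m (z + m) = pt m z := by
  simp [pt]

theorem exists_pt_eq [NeZero m] (z : ZMod m) : ∃ i : ℕ, i < m ∧ some z = pt m i :=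
  ⟨z.val, z.val_lt, by simp [pt]⟩

theorem nodup_none_cons_map_pt {l : List ℤ} (hl : l.Nodup) (b : ℤ)
    (hb : ∀ z ∈ l, b ≤ z ∧ z < b + m) : (none :: l.map (pt m)).Nodup := by
  rw [List.nodup_cons]
  refine ⟨by simp [pt], List.Nodup.map_on (fun a ha c hc hac => ?_) hl⟩
  have h1 := hb a ha
  have h2 := hb c hc
  by_contra hn
  exact pt_ne_pt hn (by omega) (by omega) hac

theorem rot_none : rot m none = none := rfl

theorem rot_pt (z : ℤ) : rot m (pt m z) = pt m (z + 1) := by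
  change some ((z : ZMod m) + 1) = some _
  push_cast
  rfl

theorem rot_pow_none (t : ℕ) : (rot m ^ t) none = none := by
  induction t with
  | zero => rfl
  | succ t ih => rw [pow_succ', Perm.mul_apply, ih, rot_none]

theorem rot_pow_pt (t : ℕ) (z : ℤ) : (rot m ^ t) (pt m z) = pt m (z + t) := by
  induction t with
  | zero => simp
  | succ t ih => rw [pow_succ', Perm.mul_apply, ih, rot_pt]; push_cast; rw [add_assoc]

theorem refl_none : refl m none = none := rfl

theorem refl_pt (z : ℤ) : refl m (pt m z) = pt m (-1 - z) := by
  change some ((-1 : ZMod m) - z) = some _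
  push_cast
  rfl

theorem nodup_pent (hr : 1 ≤ r) (hm : 4 * r + 7 ≤ m) :
    [none, pt m (-(r + 1)), pt m 0, pt m (-1), pt m r].Nodup := by
  refine nodup_none_cons_map_pt (l := [-(r + 1 : ℤ), 0, -1, r]) ?_ (-(r + 1)) ?_
  · simp; omega
  · simp; omega

theorem conj_pent (t : ℕ) : rot m ^ t * pent m r * (rot m ^ t)⁻¹ =
    fiveCycle none (pt m (-(r + 1) + t)) (pt m (0 + t)) (pt m (-1 + t)) (pt m (r + t)) := by
  rw [pent, fiveCycle.conj]
  simp only [rot_pow_none, rot_pow_pt]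

theorem sign_rot [NeZero m] (hm : Odd m) : sign (rot m) = 1 := by
  rw [rot, optionCongr_sign, sign_addRight_one]
  exact (Nat.Odd.sub_odd hm odd_one).neg_one_pow

theorem sign_refl {q : ℕ} : sign (refl (2 * q + 1)) = (-1) ^ q := by
  rw [refl, optionCongr_sign, sign_subLeft_neg_one]

theorem refl_conj_rot : refl m * rot m * (refl m)⁻¹ = (rot m)⁻¹ := by
  rw [mul_inv_eq_iff_eq_mul, eq_inv_mul_iff_mul_eq]
  ext z : 1
  obtain _ | z := z
  · rfl
  · change some (-1 - (z + 1) + 1) = some (-1 - z)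
    congr 1
    ring

theorem refl_conj_pent (hr : 1 ≤ r) (hm : 4 * r + 7 ≤ m) :
    refl m * pent m r * (refl m)⁻¹ = (pent m r)⁻¹ := by
  rw [pent, fiveCycle.inv (nodup_pent hr hm), fiveCycle.conj]
  simp only [refl_none, refl_pt]
  congr 2 <;> ring

theorem isCycle_rot [NeZero m] (hm : 1 < m) : (rot m).IsCycle := by
  refine ⟨pt m 0, ?_, ?_⟩
  · rw [rot_pt]
    exact pt_ne_pt (by omega) (by omega) (by omega)
  · rintro (_ | z) hz
    · exact absurd rot_none hz
    · obtain ⟨i, -, hi⟩ := exists_pt_eq z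
      exact ⟨i, by rw [zpow_natCast, rot_pow_pt, zero_add, hi]⟩

theorem card_support_rot [NeZero m] (hm : 1 < m) : (rot m).support.card = m := by
  have : (rot m).support = Finset.univ.map Function.Embedding.some := by
    ext z
    obtain _ | z := z
    · simp [rot_none]
    · obtain ⟨i, -, hi⟩ := exists_pt_eq z
      simp only [mem_support, Finset.mem_map, Finset.mem_univ, true_and,
        Function.Embedding.some_apply, Option.some.injEq, exists_eq, iff_true]
      rw [hi, rot_pt]
      exact pt_ne_pt (by omega) (by omega) (by omega)
  rw [this, Finset.card_map, Finset.card_univ, ZMod.card]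

theorem rot_mul_pent_pt {z b : ℤ} (hb : -(r + 1 : ℤ) ≤ z ∧ z < -(r + 1) + m) (h1 : z ≠ -(r + 1))
    (h2 : z ≠ 0) (h3 : z ≠ -1) (h4 : z ≠ r) (hm : 4 * r + 7 ≤ m) (hz : b = z + 1) :
    (rot m * pent m r) (pt m z) = pt m b := by
  rw [Perm.mul_apply, pent, fiveCycle.apply_of_notMem, rot_pt, hz]
  simp only [List.mem_cons, List.not_mem_nil, or_false, not_or]
  exact ⟨by simp [pt], pt_ne_pt h1 (by omega) (by omega), pt_ne_pt h2 (by omega) (by omega),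
    pt_ne_pt h3 (by omega) (by omega), pt_ne_pt h4 (by omega) (by omega)⟩

theorem rot_mul_pent_pt_zero (hr : 1 ≤ r) (hm : 4 * r + 7 ≤ m) :
    (rot m * pent m r) (pt m 0) = pt m 0 := by
  rw [Perm.mul_apply, pent, (fiveCycle.apply (nodup_pent hr hm)).2.2.1, rot_pt]
  rfl

/-- The product is the cycle
`none ↦ -r ↦ ⋯ ↦ -1 ↦ r + 1 ↦ ⋯ ↦ m - (r + 1) ↦ 1 ↦ ⋯ ↦ r ↦ none`. -/
theorem sameCycle_rot_mul_pent [NeZero m] (hr : 1 ≤ r) (hm : 4 * r + 7 ≤ m)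
    {z : Option (ZMod m)} (hz : z ≠ pt m 0) : (rot m * pent m r).SameCycle none z := by
  obtain ⟨a1, -, a3, -, a5⟩ := fiveCycle.apply (nodup_pent hr hm)
  obtain ⟨-, a2, -, a4, -⟩ := fiveCycle.apply (nodup_pent hr hm)
  have h0 : (rot m * pent m r).SameCycle none (pt m (-r)) := by
    have := sameCycle_apply_right.2 (SameCycle.refl (rot m * pent m r) none)
    rw [Perm.mul_apply, pent, a1, rot_pt, ← pent] at this
    rwa [show -(r + 1 : ℤ) + 1 = -r by ring] at this
  have w1 := sameCycle_of_forall_apply_eq (f := rot m * pent m r)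
    (g := fun i => pt m (-r + i)) (k := r - 1) fun i hi =>
      rot_mul_pent_pt (by omega) (by omega) (by omega) (by omega) (by omega) hm
        (by push_cast; ring)
  have w2 := sameCycle_of_forall_apply_eq (f := rot m * pent m r)
    (g := fun i => pt m (r + 1 + i)) (k := m - 2 * (r + 1)) fun i hi =>
      rot_mul_pent_pt (by omega) (by omega) (by omega) (by omega) (by omega) hm
        (by push_cast; ring)
  have w3 := sameCycle_of_forall_apply_eq (f := rot m * pent m r)
    (g := fun i => pt m (1 + i)) (k := r - 1) fun i hi =>
      rot_mul_pent_pt (by omega) (by omega) (by omega) (by omega) (by omega) hm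
        (by push_cast; ring)
  simp only [Nat.cast_zero, add_zero] at w1 w2 w3
  have h2 : (rot m * pent m r).SameCycle none (pt m (r + 1)) := by
    have := sameCycle_apply_right.2 (h0.trans (w1 (r - 1) le_rfl))
    rw [show -(r : ℤ) + ((r - 1 : ℕ) : ℤ) = -1 by omega, Perm.mul_apply, pent, a4, rot_pt,
      ← pent] at this
    exact this
  have h3 : (rot m * pent m r).SameCycle none (pt m 1) := by
    have := sameCycle_apply_right.2 (h2.trans (w2 (m - 2 * (r + 1)) le_rfl))
    rw [show (r : ℤ) + 1 + ((m - 2 * (r + 1) : ℕ) : ℤ) = -(r + 1) + m by omega, pt_add_self,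
      Perm.mul_apply, pent, a2, rot_pt, ← pent] at this
    exact this
  obtain _ | z := z
  · exact SameCycle.refl _ _
  · obtain ⟨i, hi, h⟩ := exists_pt_eq z
    rw [h] at hz ⊢
    have hi0 : i ≠ 0 := by rintro rfl; exact hz rfl
    by_cases c1 : i ≤ r
    · have := h3.trans (w3 (i - 1) (by omega))
      rwa [show (1 : ℤ) + ((i - 1 : ℕ) : ℤ) = i by omega] at this
    by_cases c2 : i ≤ m - (r + 1)
    · have := h2.trans (w2 (i - (r + 1)) (by omega))
      rwa [show (r : ℤ) + 1 + ((i - (r + 1) : ℕ) : ℤ) = i by omega] at this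
    · have := h0.trans (w1 (i + r - m) (by omega))
      rwa [← pt_add_self, show -(r : ℤ) + ((i + r - m : ℕ) : ℤ) + m = i by omega] at this

theorem rot_mul_pent_none (hr : 1 ≤ r) (hm : 4 * r + 7 ≤ m) :
    (rot m * pent m r) none ≠ none := by
  rw [Perm.mul_apply, pent, (fiveCycle.apply (nodup_pent hr hm)).1, rot_pt]
  simp [pt]

theorem isCycle_rot_mul_pent [NeZero m] (hr : 1 ≤ r) (hm : 4 * r + 7 ≤ m) :
    (rot m * pent m r).IsCycle := by
  refine ⟨none, rot_mul_pent_none hr hm, fun z hz => sameCycle_rot_mul_pent hr hm ?_⟩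
  rintro rfl
  exact hz (rot_mul_pent_pt_zero hr hm)

theorem card_support_rot_mul_pent [NeZero m] (hr : 1 ≤ r) (hm : 4 * r + 7 ≤ m) :
    (rot m * pent m r).support.card = m := by
  have : (rot m * pent m r).support = {pt m 0}ᶜ := by
    ext z
    rw [mem_support, Finset.mem_compl, Finset.mem_singleton]
    refine ⟨?_, fun hz => ?_⟩
    · rintro hz rfl
      exact hz (rot_mul_pent_pt_zero hr hm)
    · rw [Ne, ← (sameCycle_rot_mul_pent hr hm hz).apply_eq_self_iff]
      exact rot_mul_pent_none hr hm
  rw [this, Finset.card_compl, Fintype.card_option, ZMod.card, Finset.card_singleton,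
    Nat.add_sub_cancel]

/-- A block through `none` is stable under the rotation, so the group generated by the rotation and
the 5-cycle is primitive. It contains a 3-cycle, as a conjugate of the 5-cycle by a power of the
rotation meets it in `none` only. -/
theorem alternatingGroup_le_closure [NeZero m] (hr : 1 ≤ r) (hm : 4 * r + 7 ≤ m) :
    alternatingGroup (Option (ZMod m)) ≤ Subgroup.closure {rot m, pent m r} := by
  have hmem_rot : rot m ∈ Subgroup.closure {rot m, pent m r} := Subgroup.subset_closure (by simp)
  have hmem_pent : pent m r ∈ Subgroup.closure {rot m, pent m r} :=
    Subgroup.subset_closure (by simp)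
  have h3 : (pent m r * (rot m ^ (2 * r + 2) * pent m r * (rot m ^ (2 * r + 2))⁻¹) * (pent m r)⁻¹ *
      (rot m ^ (2 * r + 2) * pent m r * (rot m ^ (2 * r + 2))⁻¹)⁻¹).IsThreeCycle := by
    rw [conj_pent, pent]
    apply fiveCycle.isThreeCycle_commutator
    refine nodup_none_cons_map_pt (l := [-(r + 1 : ℤ), 0, -1, r, -(r + 1 : ℤ) + (2 * r + 2 : ℕ),
      0 + (2 * r + 2 : ℕ), -1 + (2 * r + 2 : ℕ), r + (2 * r + 2 : ℕ)]) ?_ (-(r + 1)) ?_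
    · simp; omega
    · simp; omega
  refine alternatingGroup_le_of_isPreprimitive_of_isThreeCycle_mem ?_ h3 ?_
  · refine isPreprimitive_of_forall_block (a := none) hmem_pent ?_ ?_
    · rw [pent, (fiveCycle.apply (nodup_pent hr hm)).1]
      simp [pt]
    · intro B h0 hB ⟨b, hb, hb0⟩ z
      obtain _ | b := b
      · exact absurd rfl hb0
      obtain _ | z := z
      · exact h0
      obtain ⟨i, hi, hbi⟩ := exists_pt_eq b
      obtain ⟨l, hl, hzl⟩ := exists_pt_eq z
      have h := hB (rot m ^ (l + m - i)) (pow_mem hmem_rot _) none h0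
        (by rwa [rot_pow_none]) _ hb
      rw [hbi, rot_pow_pt, show (i : ℤ) + (l + m - i : ℕ) = l + m by omega, pt_add_self] at h
      rwa [hzl]
  · have h4 := Subgroup.mul_mem _ (Subgroup.mul_mem _ (pow_mem hmem_rot (2 * r + 2)) hmem_pent)
      (Subgroup.inv_mem _ (pow_mem hmem_rot (2 * r + 2)))
    exact Subgroup.mul_mem _ (Subgroup.mul_mem _ (Subgroup.mul_mem _ hmem_pent h4)
      (Subgroup.inv_mem _ hmem_pent)) (Subgroup.inv_mem _ h4)

/-- The rotation by `2 * r + 1` takes the point `-(r + 1)` of the 5-cycle to its point `r`, and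
these two 5-cycles have no further common point besides `none`. -/
theorem pent_mul_conj_pow_eq_one (hr : 1 ≤ r) (hm : 4 * r + 7 ≤ m) :
    (pent m r * (rot m ^ (2 * r + 1) * pent m r * (rot m ^ (2 * r + 1))⁻¹)⁻¹) ^ 4 = 1 := by
  rw [conj_pent, pent, show -(r + 1 : ℤ) + (2 * r + 1 : ℕ) = r by push_cast; ring]
  apply fiveCycle.mul_inv_pow_four_eq_one
  refine nodup_none_cons_map_pt (l := [-(r + 1 : ℤ), 0, -1, r,
    0 + (2 * r + 1 : ℕ), -1 + (2 * r + 1 : ℕ), r + (2 * r + 1 : ℕ)]) ?_ (-(r + 1)) ?_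
  · simp; omega
  · simp; omega

/-- For `s ≠ r` the rotation by `2 * s + 1` either makes the 5-cycle meet its conjugate in `none`
only, or takes two of its points to two others, which happens for `r = 2 * s` and
`r = 2 * s + 1`. -/
theorem pent_mul_conj_pow_ne_one {s : ℕ} (hr : 1 ≤ r) (hm : 4 * r + 7 ≤ m) (hs : 1 ≤ s)
    (hms : 4 * s + 7 ≤ m) (hrs : r ≠ s) :
    (pent m r * (rot m ^ (2 * s + 1) * pent m r * (rot m ^ (2 * s + 1))⁻¹)⁻¹) ^ 4 ≠ 1 := by
  rw [conj_pent, pent]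
  by_cases h1 : r = 2 * s
  · rw [show -(r + 1 : ℤ) + (2 * s + 1 : ℕ) = 0 by omega,
      show -1 + ((2 * s + 1 : ℕ) : ℤ) = r by omega]
    apply fiveCycle.mul_inv_pow_four_ne_one'
    refine nodup_none_cons_map_pt (l := [-(r + 1 : ℤ), 0, -1, r,
      0 + (2 * s + 1 : ℕ), r + (2 * s + 1 : ℕ)]) ?_ (-(r + 1)) ?_
    · simp; omega
    · simp; omega
  by_cases h2 : r = 2 * s + 1
  · rw [show -(r + 1 : ℤ) + (2 * s + 1 : ℕ) = -1 by omega,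
      show 0 + ((2 * s + 1 : ℕ) : ℤ) = r by omega]
    apply fiveCycle.mul_inv_pow_four_ne_one''
    refine nodup_none_cons_map_pt (l := [-(r + 1 : ℤ), 0, -1, r,
      -1 + (2 * s + 1 : ℕ), r + (2 * s + 1 : ℕ)]) ?_ (-(r + 1)) ?_
    · simp; omega
    · simp; omega
  · apply fiveCycle.mul_inv_pow_four_ne_one
    refine nodup_none_cons_map_pt (l := [-(r + 1 : ℤ), 0, -1, r, -(r + 1 : ℤ) + (2 * s + 1 : ℕ),
      0 + (2 * s + 1 : ℕ), -1 + (2 * s + 1 : ℕ), r + (2 * s + 1 : ℕ)]) ?_ (-(r + 1)) ?_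
    · simp; omega
    · simp; omega

/-- The family of pairs consisting of the rotation and the 5-cycle with parameter `r i`, for
distinct positive numbers `r i`. -/
def family {ι : Type*} {q : ℕ} (r : ι → ℕ) (hinj : Function.Injective r) (hr : ∀ i, 1 ≤ r i)
    (hm : ∀ i, 4 * r i + 7 ≤ 2 * q + 1) :
    RealPairFamily (Option (ZMod (2 * q + 1))) ι ((-1) ^ q) {5, 2 * q + 1} where
  x _ := rot _
  y i := pent _ (r i)
  σ _ := refl _
  sign_x _ := sign_rot ⟨q, rfl⟩
  sign_y i := by
    have h := nodup_pent (hr i) (hm i)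
    rw [pent, (fiveCycle.isCycle h).sign, fiveCycle.card_support h]
    rfl
  sign_σ _ := sign_refl
  alternatingGroup_le i := alternatingGroup_le_closure (hr i) (hm i)
  separated i l hil := by
    let w : FreeGroup Bool := (FreeGroup.of false * (FreeGroup.of true ^ (2 * r i + 1) *
      FreeGroup.of false * (FreeGroup.of true ^ (2 * r i + 1))⁻¹)⁻¹) ^ 4
    have key : ∀ j, FreeGroup.lift (fun b => cond b (rot (2 * q + 1)) (pent _ (r j))) w =
        (pent _ (r j) * (rot _ ^ (2 * r i + 1) * pent _ (r j) *
          (rot _ ^ (2 * r i + 1))⁻¹)⁻¹) ^ 4 := by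
      intro j
      simp only [w, map_mul, map_inv, map_pow, FreeGroup.lift_apply_of, cond_true, cond_false]
    refine ⟨w, ?_, ?_⟩
    · rw [key]
      exact pent_mul_conj_pow_eq_one (hr i) (hm i)
    · rw [key]
      exact pent_mul_conj_pow_ne_one (hr l) (hm l) (hr i) (hm i) fun h => hil (hinj h.symm)
  inverts_x _ := refl_conj_rot
  inverts_y i := refl_conj_pent (hr i) (hm i)
  card_support_x i t ht := by
    have := hm i
    rw [(isCycle_rot (by omega)).support_pow_eq ht, card_support_rot (by omega)]
    simp
  card_support_y i t ht := by
    have h := nodup_pent (hr i) (hm i)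
    rw [pent, (fiveCycle.isCycle h).support_pow_eq ht, fiveCycle.card_support h]
    simp
  card_support_mul i t ht := by
    rw [(isCycle_rot_mul_pent (hr i) (hm i)).support_pow_eq ht,
      card_support_rot_mul_pent (hr i) (hm i)]
    simp

end PointedRotation

/-! ### Powers of alternating groups -/

theorem mainTheorem5 (n k : ℕ) (hn : 12 ≤ n) (hn_even : Even n) (hk : 0 < k)
    (hkn : (k : ℚ) ≤ ((n : ℚ) - 8) / 4) :
    IsStronglyRealBeauvilleGroup (Fin k → alternatingGroup (Fin n)) := by
  have hkn' : 4 * k + 8 ≤ n := by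
    have : (4 * k + 8 : ℚ) ≤ n := by linarith
    exact_mod_cast this
  obtain ⟨q, rfl⟩ : ∃ q, n = 2 * q + 2 := by
    obtain ⟨p, rfl⟩ := hn_even
    exact ⟨p - 1, by omega⟩
  have : NeZero (2 * q) := ⟨by omega⟩
  -- The odd parameters `1, 5, 7, 9, …`; for `3` the product would have a cycle of length `5`.
  have F := JoinedRotations.family (ι := Fin k) (m := 2 * q) (even_two_mul q) (by omega)
    (fun i => if i.val = 0 then 1 else 2 * i.val + 3)
    (by
      intro i l hil
      dsimp only at hil
      ext
      split_ifs at hil <;> omega)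
    (by
      intro i
      split_ifs
      · exact odd_one
      · exact ⟨i + 1, by omega⟩)
    (by intro i; split_ifs <;> omega)
    (by intro i; split_ifs <;> omega)
    (by intro i l; split_ifs <;> omega)
  have F' := PointedRotation.family (ι := Fin k) (q := q) (fun i => i.val + 1)
    (fun i l h => Fin.ext (Nat.succ_injective h)) (fun i => Nat.le_add_left 1 _)
    (fun i => by have := i.2; omega)
  have e : ZMod (2 * q) ⊕ ZMod 2 ≃ Fin (2 * q + 2) :=
    Fintype.equivFinOfCardEq (by simp [ZMod.card])
  have e' : Option (ZMod (2 * q + 1)) ≃ Fin (2 * q + 2) :=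
    Fintype.equivFinOfCardEq (by simp [ZMod.card])
  have hq : 2 * q / 2 = q := by omega
  rw [hq] at F
  exact (F.map e).isStronglyRealBeauvilleGroup (F'.map e') (by simp; omega)
    disjoint_compl_left
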